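/- **Setting.** Let $M$ be a finite set of men and $W$ a finite set of women with $|M|=|W|$. Each man $m$ has a strict total order $\succ_m$ on $W$ and each woman $w$ a strict total order $\succ_w$ on $M$; let $\succ$ be the resulting profile and let $\mathrm{DA}(\succ)$ denote the matching produced by the men-proposing deferred acceptance algorithm. Put $\mu=\mathrm{DA}(\succ)$ and fix a man $m$ (the accomplice). For $X\subseteq W$, *pushing up* $X$ means that $m$ replaces his list by one in which, among the women other than $\mu(m)$, those ranked above $\mu(m)$ are exactly the women whom he truly ranks above $\mu(m)$ together with the women of $X$; the order within the part above and the part below $\mu(m)$ may be chosen arbitrarily (one fixed choice for each $X$). All other agents report truthfully, and $\mu^X$ denotes the resulting deferred acceptance matching. The *no-regret set* is $$W^{\mathrm{NR}}=\{w\in W:\ \mu^{\{w\}}(m)\succeq_m\mu(m)\}.$$ A set $Y\subseteq W^{\mathrm{NR}}$ is a *minimal no-regret push-up set* if $\mu^Y=\mu^{W^{\mathrm{NR}}}$ and no proper subset $Z\subsetneq Y$ satisfies $\mu^Z=\mu^{W^{\mathrm{NR}}}$. It is a *minimum no-regret push-up set* if $\mu^Y=\mu^{W^{\mathrm{NR}}}$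 and no $Z\subseteq W^{\mathrm{NR}}$ with $|Z|<|Y|$ satisfies $\mu^Z=\mu^{W^{\mathrm{NR}}}$. **Theorem.** Every minimal no-regret push-up set is a minimum no-regret push-up set. -/

import Mathlib

namespace StableMarriage

/-- A preference list over `α`: a strict total order, `prefers a b` meaning that `a` is ranked
strictly above `b`. -/
structure PrefList (α : Type*) where
  prefers : α → α → Prop
  irrefl : ∀ a, ¬ prefers a a
  trans : ∀ a b c, prefers a b → prefers b c → prefers a c
  total : ∀ a b, prefers a b ∨ a = b ∨ prefers b a

/-- Weak preference: `a` is ranked above `b`, or `a = b`. -/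
def PrefList.weaklyPrefers {α : Type*} (L : PrefList α) (a b : α) : Prop :=
  L.prefers a b ∨ a = b

/-- A preference profile of a stable marriage instance with equally many men and women: each man has
a complete list of the women and each woman has a complete list of the men. -/
structure Profile (M W : Type*) [Fintype M] [Fintype W] where
  card_eq : Fintype.card M = Fintype.card W
  men : M → PrefList W
  women : W → PrefList M

/-- Every nonempty set of alternatives of a finite list has a favourite. -/
theorem PrefList.exists_favourite {α : Type*} [Finite α] (L : PrefList α) (S : Set α)
    (hS : S.Nonempty) : ∃ a ∈ S, ∀ b ∈ S, L.weaklyPrefers a b := by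
  have : IsTrans α L.prefers := ⟨L.trans⟩
  have : Std.Irrefl L.prefers := ⟨L.irrefl⟩
  have wf : WellFounded L.prefers := Finite.wellFounded_of_trans_of_irrefl _
  obtain ⟨a, ha, hmin⟩ := wf.has_min S hS
  refine ⟨a, ha, fun b hb => ?_⟩
  rcases L.total a b with h | h | h
  · exact Or.inl h
  · exact Or.inr h
  · exact absurd h (hmin b hb)

theorem PrefList.weaklyPrefers_antisymm {α : Type*} (L : PrefList α) {a b : α}
    (h₁ : L.weaklyPrefers a b) (h₂ : L.weaklyPrefers b a) : a = b := by
  rcases h₁ with h₁ | h₁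
  · rcases h₂ with h₂ | h₂
    · exact absurd (L.trans _ _ _ h₁ h₂) (L.irrefl a)
    · exact h₂.symm
  · exact h₁

namespace Profile

variable {M W : Type*} [Fintype M] [Fintype W]

/-! ### The deferred acceptance algorithm

The state of the algorithm is the set `R` of pairs `(m, w)` such that `w` has already rejected `m`.
In the proposal phase every man addresses his favourite woman among those who have not rejected
him (for a man who is tentatively accepted this is the woman holding him, so only unmatched men
make new proposals); in the rejection phase every woman keeps her favourite man among those
addressing her and rejects the others. -/

/-- Given the rejections `R` so far, `w` is the favourite of `m` among the women who have not
rejected him. -/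
def Proposes (P : Profile M W) (R : Set (M × W)) (m : M) (w : W) : Prop :=
  (m, w) ∉ R ∧ ∀ w', (m, w') ∉ R → (P.men m).weaklyPrefers w w'

/-- One round: `w` rejects every proposer that she likes less than some other proposer. -/
def daStep (P : Profile M W) (R : Set (M × W)) : Set (M × W) :=
  R ∪ {q | P.Proposes R q.1 q.2 ∧ ∃ m', P.Proposes R m' q.2 ∧ (P.women q.2).prefers m' q.1}

/-- All rejections in the run of deferred acceptance. Every round before termination adds a
rejection, so the run has stopped after `|M| * |W|` rounds. -/
def daRejections (P : Profile M W) : Set (M × W) :=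
  P.daStep^[Fintype.card (M × W)] ∅

theorem subset_daStep (P : Profile M W) (R : Set (M × W)) : R ⊆ P.daStep R :=
  Set.subset_union_left

/-- The run has indeed terminated: a further round rejects nobody. -/
theorem daStep_daRejections (P : Profile M W) : P.daStep P.daRejections = P.daRejections := by
  by_contra hne
  have hfix : ∀ k ≤ Fintype.card (M × W), P.daStep (P.daStep^[k] ∅) ≠ P.daStep^[k] ∅ := by
    intro k hk h
    apply hne
    have hall : ∀ j, P.daStep^[k + j] ∅ = P.daStep^[k] ∅ := by
      intro j
      induction j with
      | zero => rfl
      | succ j ih => rw [← Nat.add_assoc, Function.iterate_succ_apply', ih, h]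
    obtain ⟨j, hj⟩ := Nat.exists_eq_add_of_le hk
    unfold daRejections
    rw [hj, hall j, h]
  have hgrow : ∀ k ≤ Fintype.card (M × W) + 1, k ≤ (P.daStep^[k] ∅).ncard := by
    intro k
    induction k with
    | zero => intro _; exact Nat.zero_le _
    | succ k ih =>
      intro hk
      have h1 := ih (by omega)
      have h2 : (P.daStep^[k] ∅).ncard < (P.daStep^[k + 1] ∅).ncard := by
        rw [Function.iterate_succ_apply']
        refine Set.ncard_lt_ncard ?_ (Set.toFinite _)
        exact (P.subset_daStep _).ssubset_of_ne (hfix k (by omega)).symm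
      omega
  have h1 := hgrow _ le_rfl
  have h2 := Set.ncard_le_card (P.daStep^[Fintype.card (M × W) + 1] ∅)
  rw [Nat.card_eq_fintype_card] at h2
  omega

theorem Proposes.unique {P : Profile M W} {R : Set (M × W)} {m : M} {w w' : W}
    (h : P.Proposes R m w) (h' : P.Proposes R m w') : w = w' :=
  (P.men m).weaklyPrefers_antisymm (h.2 _ h'.1) (h'.2 _ h.1)

/-- A woman who has rejected somebody is addressed by some man. -/
theorem exists_proposes_of_mem (P : Profile M W) (k : ℕ) :
    ∀ m w, (m, w) ∈ P.daStep^[k] ∅ → ∃ m', P.Proposes (P.daStep^[k] ∅) m' w := by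
  induction k with
  | zero => intro m w h; exact absurd h (Set.notMem_empty _)
  | succ k ih =>
    intro m w h
    rw [Function.iterate_succ_apply'] at h ⊢
    set R := P.daStep^[k] ∅
    have hne : {m' | P.Proposes R m' w}.Nonempty := by
      rcases h with h | h
      · exact ih m w h
      · exact ⟨m, h.1⟩
    obtain ⟨b, hb, hbest⟩ := (P.women w).exists_favourite _ hne
    refine ⟨b, ?_, fun w' hw' => hb.2 w' fun h' => hw' (P.subset_daStep R h')⟩
    rintro (h' | ⟨-, m', hm', hpref⟩)
    · exact hb.1 h'
    · rcases hbest m' hm' with h'' | h''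
      · exact (P.women w).irrefl _ ((P.women w).trans _ _ _ h'' hpref)
      · subst h''; exact (P.women w).irrefl _ hpref

/-- No man is rejected by all women. -/
theorem exists_proposes (P : Profile M W) (m : M) : ∃ w, P.Proposes P.daRejections m w := by
  by_contra hno
  have hall : ∀ w, (m, w) ∈ P.daRejections := by
    by_contra! hex
    obtain ⟨w, hw⟩ := hex
    obtain ⟨a, ha, hbest⟩ :=
      (P.men m).exists_favourite {w | (m, w) ∉ P.daRejections} ⟨w, hw⟩
    exact hno ⟨a, ha, hbest⟩
  choose f hf using fun w => P.exists_proposes_of_mem _ m w (hall w)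
  have hinj : Function.Injective f := by
    intro w w' h
    have h1 := hf w
    rw [h] at h1
    exact h1.unique (hf w')
  have hsurj : Function.Surjective f :=
    ((Fintype.bijective_iff_injective_and_card f).2 ⟨hinj, P.card_eq.symm⟩).2
  obtain ⟨w, hw⟩ := hsurj m
  exact hno ⟨w, hw ▸ hf w⟩

/-- At termination no two men address the same woman. -/
theorem proposes_injective (P : Profile M W) {m m' : M} {w : W}
    (h : P.Proposes P.daRejections m w) (h' : P.Proposes P.daRejections m' w) : m = m' := by
  have key : ∀ a b : M, P.Proposes P.daRejections a w → P.Proposes P.daRejections b w →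
      ¬ (P.women w).prefers a b := by
    intro a b ha hb hab
    have : (b, w) ∈ P.daStep P.daRejections := Or.inr ⟨hb, a, ha, hab⟩
    rw [P.daStep_daRejections] at this
    exact hb.1 this
  rcases (P.women w).total m m' with h1 | h1 | h1
  · exact absurd h1 (key _ _ h h')
  · exact h1
  · exact absurd h1 (key _ _ h' h)

theorem bijective_choose_proposes (P : Profile M W) :
    Function.Bijective fun m => (P.exists_proposes m).choose := by
  refine (Fintype.bijective_iff_injective_and_card _).2 ⟨fun m m' h => ?_, P.card_eq⟩
  refine P.proposes_injective (P.exists_proposes m).choose_spec ?_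
  have h' : (P.exists_proposes m).choose = (P.exists_proposes m').choose := h
  rw [h']
  exact (P.exists_proposes m').choose_spec

/-- The outcome of men-proposing deferred acceptance: each man is matched with the woman he
addresses when the algorithm has terminated. -/
noncomputable def DA (P : Profile M W) : M ≃ W :=
  Equiv.ofBijective _ P.bijective_choose_proposes

open Classical in
/-- The profile in which the man `m` reports the list `L` and everybody else reports truthfully. -/
noncomputable def withList (P : Profile M W) (m : M) (L : PrefList W) : Profile M W :=
  { P with men := Function.update P.men m L }

/-- `L'` is a list of the man `m` with true list `(A, μ(m), B)`, where `μ` is the deferred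
acceptance matching, after pushing up `X`, that is, a list `(A ∪ X, μ(m), B \ X)`.
The order within the two parts is left free. Pushing up `μ(m)` itself has no effect. -/
def IsPushUp (P : Profile M W) (m : M) (X : Finset W) (L' : PrefList W) : Prop :=
  ∀ w, w ≠ P.DA m → (L'.prefers w (P.DA m) ↔ ((P.men m).prefers w (P.DA m) ∨ w ∈ X))

/-- A choice, for every set `X` of women, of the positions at which they are placed when the man
`m` pushes up `X`. -/
def PushUpRule (P : Profile M W) (m : M) : Type _ :=
  (X : Finset W) → {L' : PrefList W // P.IsPushUp m X L'}

/-- Every set of women can be pushed up: rank the women above `μ(m)` or in `X` first, then `μ(m)`,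
then the others, each part in the true order. -/
theorem exists_isPushUp (P : Profile M W) (m : M) (X : Finset W) :
    ∃ L', P.IsPushUp m X L' := by
  classical
  let c := P.DA m
  let L := P.men m
  let t : W → ℕ := fun w => if w = c then 1 else if L.prefers w c ∨ w ∈ X then 0 else 2
  refine ⟨⟨fun a b => t a < t b ∨ (t a = t b ∧ L.prefers a b), ?_, ?_, ?_⟩, ?_⟩
  · rintro a (h | h)
    · exact lt_irrefl _ h
    · exact L.irrefl a h.2
  · rintro a b d (h | h) (h' | h')
    · exact Or.inl (h.trans h')
    · exact Or.inl (h'.1 ▸ h)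
    · exact Or.inl (h.1 ▸ h')
    · exact Or.inr ⟨h.1.trans h'.1, L.trans _ _ _ h.2 h'.2⟩
  · intro a b
    rcases lt_trichotomy (t a) (t b) with h | h | h
    · exact Or.inl (Or.inl h)
    · rcases L.total a b with h' | h' | h'
      · exact Or.inl (Or.inr ⟨h, h'⟩)
      · exact Or.inr (Or.inl h')
      · exact Or.inr (Or.inr (Or.inr ⟨h.symm, h'⟩))
    · exact Or.inr (Or.inr (Or.inl h))
  · intro w hw
    have hw' : w ≠ c := hw
    have hc : t c = 1 := if_pos rfl
    change (t w < t c ∨ (t w = t c ∧ L.prefers w c)) ↔ (L.prefers w c ∨ w ∈ X)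
    by_cases h : L.prefers w c ∨ w ∈ X
    · have : t w = 0 := by simp only [t, if_neg hw', if_pos h]
      simp [this, hc, h]
    · have : t w = 2 := by simp only [t, if_neg hw', if_neg h]
      simp [this, hc, h]

instance (P : Profile M W) (m : M) : Nonempty (P.PushUpRule m) :=
  ⟨fun X => ⟨_, (P.exists_isPushUp m X).choose_spec⟩⟩

/-- The deferred acceptance matching after the accomplice `m` pushes up `X`. -/
noncomputable def pushUpMatching (P : Profile M W) (m : M) (up : P.PushUpRule m)
    (X : Finset W) : M ≃ W :=
  (P.withList m (up X).1).DA

open Classical in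
/-- The no-regret set: the women who, when pushed up individually, do not worsen the match of the
accomplice `m` with respect to his true list. -/
noncomputable def noRegretSet (P : Profile M W) (m : M) (up : P.PushUpRule m) : Finset W :=
  Finset.univ.filter fun w =>
    (P.men m).weaklyPrefers (P.pushUpMatching m up {w} m) (P.DA m)

/-- `Y` is a set of no-regret women inducing the same matching as the whole no-regret set, and no
proper subset of `Y` induces that matching. -/
def IsMinimalNoRegretPushUpSet (P : Profile M W) (m : M) (up : P.PushUpRule m)
    (Y : Finset W) : Prop :=
  Y ⊆ P.noRegretSet m up ∧
    P.pushUpMatching m up Y = P.pushUpMatching m up (P.noRegretSet m up) ∧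
    ¬ ∃ Z : Finset W,
      P.pushUpMatching m up Z = P.pushUpMatching m up (P.noRegretSet m up) ∧ Z ⊂ Y

/-- `Y` is a set of no-regret women inducing the same matching as the whole no-regret set, and no
set of no-regret women of smaller size induces that matching. -/
def IsMinimumNoRegretPushUpSet (P : Profile M W) (m : M) (up : P.PushUpRule m)
    (Y : Finset W) : Prop :=
  Y ⊆ P.noRegretSet m up ∧
    P.pushUpMatching m up Y = P.pushUpMatching m up (P.noRegretSet m up) ∧
    ¬ ∃ Z : Finset W, Z ⊆ P.noRegretSet m up ∧
      P.pushUpMatching m up Z = P.pushUpMatching m up (P.noRegretSet m up) ∧ Z.card < Y.card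

end Profile

end StableMarriage

/-! Write `N` for the no-regret set. While `m` keeps `μ(m)`, a matching is stable for the pushed-up
list iff it is truly stable and every `x ∈ X` declines `m` (`isStable_withList_iff`). So for `X ⊆ N`
the matching `μ^X` is the women-worst such matching, once `m` is known to keep `μ(m)`. That, and the
fact that `μ^X` is the join of `μ` and the `μ^{y}` with `y ∈ X`, is
`pushUpMatching_apply_of_subset`; it rests on lattice joins and on the blocking lemma
`not_prefers_DA_of_stable_off`.

Hence `μ^Y = μ^N` iff every `x ∈ N` declines `m` under `μ` or under some `μ^{y}`, `y ∈ Y`. "`x`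
declines under `μ^{y}`" is transitive, so this is a covering problem in which minimal covers pick
one element from each maximal class not covered for free, and all have the same size
(`card_le_card_of_minimal_cover`). -/

namespace StableMarriage

/-! ### Strict and weak preference. -/

namespace PrefList

variable {α : Type*} (L : PrefList α)

theorem asymm {a b : α} (h : L.prefers a b) : ¬ L.prefers b a :=
  fun h' => L.irrefl a (L.trans _ _ _ h h')

theorem not_prefers {a b : α} : ¬ L.prefers a b ↔ L.weaklyPrefers b a := by
  constructor
  · intro h
    rcases L.total a b with h' | h' | h'
    · exact absurd h' h
    · exact Or.inr h'.symm
    · exact Or.inl h'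
  · rintro (h | rfl)
    · exact L.asymm h
    · exact L.irrefl _

variable {L}

theorem prefers.trans_weaklyPrefers {a b c : α} (h : L.prefers a b) (h' : L.weaklyPrefers b c) :
    L.prefers a c := by
  rcases h' with h' | rfl
  · exact L.trans _ _ _ h h'
  · exact h

theorem weaklyPrefers.trans_prefers {a b c : α} (h : L.weaklyPrefers a b) (h' : L.prefers b c) :
    L.prefers a c := by
  rcases h with h | rfl
  · exact L.trans _ _ _ h h'
  · exact h'

theorem weaklyPrefers.trans {a b c : α} (h : L.weaklyPrefers a b) (h' : L.weaklyPrefers b c) :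
    L.weaklyPrefers a c := by
  rcases h with h | rfl
  · exact Or.inl (h.trans_weaklyPrefers h')
  · exact h'

end PrefList

/-- In a preorder with a lower set `B` that is covered for free, any minimal subset of `N` covering
`N` has at most as many elements as any other covering subset of `N`. -/
theorem card_le_card_of_minimal_cover {α : Type*} {N Y Z : Finset α} {B : α → Prop}
    {D : α → α → Prop}
    (htrans : ∀ x ∈ N, ∀ y ∈ N, ∀ z ∈ N, D x y → D y z → D x z)
    (hB : ∀ x ∈ N, ∀ y ∈ N, D x y → B y → B x)
    (hYN : Y ⊆ N) (hZN : Z ⊆ N)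
    (hY : ∀ x ∈ N, B x ∨ ∃ y ∈ Y, D x y) (hZ : ∀ x ∈ N, B x ∨ ∃ z ∈ Z, D x z)
    (hmin : ∀ Y' ⊂ Y, ¬ ∀ x ∈ N, B x ∨ ∃ y ∈ Y', D x y) : Y.card ≤ Z.card := by
  classical
  -- By minimality no element of `Y` is redundant: whatever it covers would be covered without it.
  have herase : ∀ y ∈ Y, ¬ (B y ∨ ∃ y' ∈ Y, y' ≠ y ∧ D y y') := by
    intro y hy h
    refine hmin _ (Finset.erase_ssubset hy) fun x hx => ?_
    rcases hY x hx with hx' | ⟨v, hv, hxv⟩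
    · exact Or.inl hx'
    by_cases hvy : v = y
    · subst hvy
      rcases h with h | ⟨y', hy', hne, hd⟩
      · exact Or.inl (hB x hx v (hYN hv) hxv h)
      · exact Or.inr ⟨y', Finset.mem_erase.2 ⟨hne, hy'⟩,
          htrans x hx v (hYN hv) y' (hYN hy') hxv hd⟩
    · exact Or.inr ⟨v, Finset.mem_erase.2 ⟨hvy, hv⟩, hxv⟩
  -- Some `z ∈ Z` covers `y`, and the element of `Y` covering `z` can only be `y` itself. Two
  -- elements of `Y` sharing such a `z` would cover each other.
  have hex : ∀ y ∈ Y, ∃ z ∈ Z, D y z ∧ D z y := by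
    intro y hy
    rcases hZ y (hYN hy) with h | ⟨z, hz, hyz⟩
    · exact absurd (Or.inl h) (herase y hy)
    rcases hY z (hZN hz) with h | ⟨v, hv, hzv⟩
    · exact absurd (Or.inl (hB y (hYN hy) z (hZN hz) hyz h)) (herase y hy)
    by_cases hvy : v = y
    · subst hvy
      exact ⟨z, hz, hyz, hzv⟩
    · exact absurd (Or.inr ⟨v, hv, hvy,
        htrans y (hYN hy) z (hZN hz) v (hYN hv) hyz hzv⟩) (herase y hy)
  choose! f hfZ hf hf' using hex
  refine Finset.card_le_card_of_injOn f hfZ fun a ha b hb hab => ?_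
  by_contra hne
  have hab' : D (f a) b := hab ▸ hf' b hb
  exact herase a ha (Or.inr ⟨b, hb, Ne.symm hne,
    htrans a (hYN ha) (f a) (hZN (hfZ a ha)) b (hYN hb) (hf a ha) hab'⟩)

namespace Profile

variable {M W : Type*} [Fintype M] [Fintype W] {P : Profile M W}

/-- No pair of agents prefer each other to their partners: every woman whom a man prefers to his
partner prefers her own partner to him. -/
def IsStable (P : Profile M W) (ν : M ≃ W) : Prop :=
  ∀ a w, (P.men a).prefers w (ν a) → (P.women w).prefers (ν.symm w) a

/-! ### Properties of deferred acceptance -/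

theorem DA_proposes (P : Profile M W) (a : M) : P.Proposes P.daRejections a (P.DA a) :=
  (P.exists_proposes a).choose_spec

/-- The best current proposer survives the round and, as rejections only grow, keeps addressing `w`.
-/
theorem exists_favourite_proposer (P : Profile M W) {R : Set (M × W)} {a : M} {w : W}
    (h : P.Proposes R a w) :
    ∃ b, P.Proposes R b w ∧ P.Proposes (P.daStep R) b w ∧
      ∀ c, P.Proposes R c w → (P.women w).weaklyPrefers b c := by
  obtain ⟨b, hb, hbest⟩ := (P.women w).exists_favourite {c | P.Proposes R c w} ⟨a, h⟩
  refine ⟨b, hb, ⟨?_, fun w' hw' => hb.2 w' fun h' => hw' (P.subset_daStep R h')⟩, hbest⟩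
  rintro (h' | ⟨-, c, hc, hcb⟩)
  · exact hb.1 h'
  · exact (PrefList.not_prefers _).2 (hbest c hc) hcb

/-- At every stage a woman is addressed by a man whom she prefers to all the men she has
rejected. -/
theorem exists_proposes_prefers (P : Profile M W) (k : ℕ) :
    ∀ a w, (a, w) ∈ P.daStep^[k] ∅ →
      ∃ b, P.Proposes (P.daStep^[k] ∅) b w ∧ (P.women w).prefers b a := by
  induction k with
  | zero => intro a w h; exact absurd h (Set.notMem_empty _)
  | succ k ih =>
    intro a w h
    rw [Function.iterate_succ_apply'] at h ⊢
    obtain ⟨c, hc, hca⟩ : ∃ c, P.Proposes (P.daStep^[k] ∅) c w ∧ (P.women w).prefers c a := by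
      rcases h with h | ⟨-, c, hc, hca⟩
      · exact ih a w h
      · exact ⟨c, hc, hca⟩
    obtain ⟨b, -, hb, hbest⟩ := P.exists_favourite_proposer hc
    exact ⟨b, hb, (hbest c hc).trans_prefers hca⟩

theorem daRejections_of_prefers {a : M} {w : W} (h : (P.men a).prefers w (P.DA a)) :
    (a, w) ∈ P.daRejections := by
  by_contra h'
  exact (PrefList.not_prefers _).2 ((P.DA_proposes a).2 w h') h

theorem DA_isStable (P : Profile M W) : P.IsStable P.DA := by
  intro a w h
  obtain ⟨b, hb, hba⟩ := P.exists_proposes_prefers _ a w (daRejections_of_prefers h)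
  have : P.DA.symm w = b := by
    rw [Equiv.symm_apply_eq]
    exact hb.unique (P.DA_proposes b)
  rwa [this]

/-- A man is never rejected by a woman with whom some stable matching pairs him. -/
theorem IsStable.notMem_iterate {ν : M ≃ W} (hν : P.IsStable ν) (k : ℕ) :
    ∀ a, (a, ν a) ∉ P.daStep^[k] ∅ := by
  induction k with
  | zero => intro a h; exact absurd h (Set.notMem_empty _)
  | succ k ih =>
    intro a h
    rw [Function.iterate_succ_apply'] at h
    rcases h with h | ⟨-, b, hb, hba⟩
    · exact ih a h
    simp only at hb hba
    -- By induction `ν b` has not rejected `b`, so `b` likes `ν a` at least as much; if strictly,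
    -- `b` and `ν a` would block `ν`.
    rcases hb.2 (ν b) (ih b) with hw | hw
    · have := hν b _ hw
      rw [Equiv.symm_apply_apply] at this
      exact PrefList.asymm _ hba this
    · rw [ν.injective hw] at hba
      exact PrefList.irrefl _ _ hba

theorem IsStable.men_weaklyPrefer_DA {ν : M ≃ W} (hν : P.IsStable ν) (a : M) :
    (P.men a).weaklyPrefers (P.DA a) (ν a) :=
  (P.DA_proposes a).2 _ (hν.notMem_iterate _ a)

/-- Man-optimality makes `w`'s deferred acceptance partner want her at least as much as his
`ν`-partner, so stability of `ν` forces her to do no worse in `ν`. -/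
theorem IsStable.women_weaklyPrefer {ν : M ≃ W} (hν : P.IsStable ν) (w : W) :
    (P.women w).weaklyPrefers (ν.symm w) (P.DA.symm w) := by
  rcases hν.men_weaklyPrefer_DA (P.DA.symm w) with h | h
  · rw [Equiv.apply_symm_apply] at h
    exact Or.inl (hν _ _ h)
  · rw [Equiv.apply_symm_apply] at h
    exact Or.inr ((Equiv.symm_apply_eq _).2 h)

/-- If a matching `ν` gives the man `m` a better partner than deferred acceptance does, then it is
blocked by a pair not involving `m`. -/
theorem not_prefers_DA_of_stable_off {ν : M ≃ W} {m : M}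
    (hν : ∀ a, a ≠ m → ∀ w, (P.men a).prefers w (ν a) → (P.women w).prefers (ν.symm w) a) :
    ¬ (P.men m).prefers (ν m) (P.DA m) := by
  intro hm
  let S : Set M := {a | (P.men a).prefers (ν a) (P.DA a)}
  have hmS : m ∈ S := hm
  have hS : ∀ a ∉ S, ∀ w, (P.men a).prefers w (P.DA a) → (P.women w).prefers (ν.symm w) a := by
    intro a ha w hw
    refine hν a (fun h => ha (h ▸ hmS)) w ?_
    exact hw.trans_weaklyPrefers ((PrefList.not_prefers _).1 ha)
  -- Otherwise `ν a` and her deferred acceptance partner would block `ν`, and that partner is not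
  -- `m`.
  have hback : ∀ a ∈ S, P.DA.symm (ν a) ∈ S := by
    intro a ha
    by_contra hb
    have h1 := P.DA_isStable a (ν a) ha
    have hne : P.DA.symm (ν a) ≠ a := fun h => PrefList.irrefl _ _ (h ▸ h1)
    have h2 : (P.men (P.DA.symm (ν a))).prefers (ν a) (ν (P.DA.symm (ν a))) := by
      rcases (PrefList.not_prefers _).1 hb with h | h
      · rwa [Equiv.apply_symm_apply] at h
      · rw [Equiv.apply_symm_apply] at h
        exact absurd (ν.injective h).symm hne
    have h3 := hν (P.DA.symm (ν a)) (fun h => hb (h.symm ▸ hmS)) _ h2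
    rw [Equiv.symm_apply_apply] at h3
    exact PrefList.asymm _ h1 h3
  have hfwd : ∀ a ∈ S, ν.symm (P.DA a) ∈ S :=
    Equiv.Perm.perm_symm_mapsTo_of_mapsTo (ν.trans P.DA.symm) hback
  -- Look at the last round in which some `a ∈ S` newly addresses his final partner `w`. Her
  -- `ν`-partner `b ∈ S` has been rejected by then, so she holds some `d` better than `b`. This `d`
  -- lies outside `S`, is later rejected by `w`, and blocks `ν` with her.
  let Q : ℕ → Prop := fun k => ∀ a ∈ S, P.Proposes (P.daStep^[k] ∅) a (P.DA a)
  have hQ : ∃ k, Q k := ⟨_, fun a _ => P.DA_proposes a⟩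
  have hQ0 : ¬ Q 0 := by
    intro h
    exact (PrefList.not_prefers _).2 ((h m hmS).2 (ν m) (Set.notMem_empty _)) hm
  classical
  obtain ⟨k, hk, hk'⟩ : ∃ k, ¬ Q k ∧ Q (k + 1) := by
    obtain ⟨k, hk⟩ := Nat.exists_eq_succ_of_ne_zero
      (fun h => hQ0 (h ▸ Nat.find_spec hQ) : Nat.find hQ ≠ 0)
    refine ⟨k, Nat.find_min hQ (by omega), ?_⟩
    have := Nat.find_spec hQ
    rwa [hk] at this
  obtain ⟨a, haS, ha⟩ : ∃ a ∈ S, ¬ P.Proposes (P.daStep^[k] ∅) a (P.DA a) := by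
    simpa [Q] using hk
  set w := P.DA a with hw
  have hbS := hfwd a haS
  set b := ν.symm w with hb
  have hbw : (P.men b).prefers w (P.DA b) := by
    have : (P.men b).prefers (ν b) (P.DA b) := hbS
    rwa [hb, Equiv.apply_symm_apply] at this
  have hrej : (b, w) ∈ P.daStep^[k + 1] ∅ := by
    by_contra h
    exact (PrefList.not_prefers _).2 ((hk' b hbS).2 w h) hbw
  rw [Function.iterate_succ_apply'] at hrej
  obtain ⟨c, hc, hcb⟩ : ∃ c, P.Proposes (P.daStep^[k] ∅) c w ∧ (P.women w).prefers c b := by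
    rcases hrej with h | ⟨-, c, hc, hcb⟩
    · exact P.exists_proposes_prefers k b w h
    · exact ⟨c, hc, hcb⟩
  obtain ⟨d, hd, hd', hbest⟩ := P.exists_favourite_proposer hc
  have hda : d ≠ a := fun h => ha (h ▸ hd)
  have hdw : P.DA d ≠ w := fun h => hda (P.DA.injective h)
  have hdS : d ∉ S := by
    intro h
    have h1 := hk' d h
    rw [Function.iterate_succ_apply'] at h1
    exact hdw (h1.unique hd')
  have hdpref : (P.men d).prefers w (P.DA d) := by
    have hmem : (d, P.DA d) ∉ P.daStep^[k] ∅ := P.DA_isStable.notMem_iterate k d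
    rcases hd.2 _ hmem with h | h
    · exact h
    · exact absurd h.symm hdw
  exact PrefList.asymm _ (hS d hdS w hdpref) ((hbest c hc).trans_prefers hcb)

/-- Two stable matchings have a common upper bound in the women's order in which every woman keeps
one of her two partners. -/
theorem IsStable.exists_join {ν₁ ν₂ : M ≃ W} (h₁ : P.IsStable ν₁) (h₂ : P.IsStable ν₂) :
    ∃ ν : M ≃ W, P.IsStable ν ∧ ∀ w, (ν.symm w = ν₁.symm w ∨ ν.symm w = ν₂.symm w) ∧
      (P.women w).weaklyPrefers (ν.symm w) (ν₁.symm w) ∧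
      (P.women w).weaklyPrefers (ν.symm w) (ν₂.symm w) := by
  have hex : ∀ w, ∃ a, (a = ν₁.symm w ∨ a = ν₂.symm w) ∧
      (P.women w).weaklyPrefers a (ν₁.symm w) ∧ (P.women w).weaklyPrefers a (ν₂.symm w) := by
    intro w
    by_cases h : (P.women w).prefers (ν₁.symm w) (ν₂.symm w)
    · exact ⟨_, Or.inl rfl, Or.inr rfl, Or.inl h⟩
    · exact ⟨_, Or.inr rfl, (PrefList.not_prefers _).1 h, Or.inr rfl⟩
  choose f hf hf₁ hf₂ using hex
  -- If two women chose the same man, the one he prefers would, by stability of the matching giving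
  -- him the other, have a strictly better partner there than her choice.
  have key : ∀ {ν ν' : M ≃ W}, P.IsStable ν → P.IsStable ν' →
      (∀ w, (P.women w).weaklyPrefers (f w) (ν.symm w)) →
      (∀ w, (P.women w).weaklyPrefers (f w) (ν'.symm w)) →
      ∀ v w, f v = f w → f v = ν.symm v → f w = ν'.symm w → v = w := by
    intro ν ν' hν hν' hfν hfν' v w hvw hv hw
    have hv' : ν (f v) = v := by rw [hv, Equiv.apply_symm_apply]
    have hw' : ν' (f v) = w := by rw [hvw, hw, Equiv.apply_symm_apply]
    rcases (P.men (f v)).total v w with h | h | h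
    · have := hν' (f v) v (hw'.symm ▸ h)
      exact absurd this ((PrefList.not_prefers _).2 (hfν' v))
    · exact h
    · have := hν (f v) w (hv'.symm ▸ h)
      rw [hvw] at this
      exact absurd this ((PrefList.not_prefers _).2 (hfν w))
  have hinj : Function.Injective f := by
    intro v w hvw
    rcases hf v with hv | hv <;> rcases hf w with hw | hw
    · exact key h₁ h₁ hf₁ hf₁ v w hvw hv hw
    · exact key h₁ h₂ hf₁ hf₂ v w hvw hv hw
    · exact key h₂ h₁ hf₂ hf₁ v w hvw hv hw
    · exact key h₂ h₂ hf₂ hf₂ v w hvw hv hw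
  have hbij : Function.Bijective f :=
    (Fintype.bijective_iff_injective_and_card f).2 ⟨hinj, P.card_eq.symm⟩
  refine ⟨(Equiv.ofBijective f hbij).symm, ?_, fun w => ⟨hf w, hf₁ w, hf₂ w⟩⟩
  intro a w hw
  obtain ⟨v, rfl⟩ := hbij.2 a
  have hv : (Equiv.ofBijective f hbij).symm (f v) = v := Equiv.ofBijective_symm_apply_apply f hbij v
  rw [hv] at hw
  rcases hf v with h | h
  · exact (hf₁ w).trans_prefers (h₁ (f v) w (by rwa [h, Equiv.apply_symm_apply, ← h]))
  · exact (hf₂ w).trans_prefers (h₂ (f v) w (by rwa [h, Equiv.apply_symm_apply, ← h]))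

/-! ### Pushing up -/

theorem withList_men_self (P : Profile M W) (m : M) (L : PrefList W) :
    (P.withList m L).men m = L := by
  classical
  simp [withList]

theorem withList_men_of_ne (P : Profile M W) {m a : M} (h : a ≠ m) (L : PrefList W) :
    (P.withList m L).men a = P.men a := by
  classical
  simp [withList, h]

/-- Under `ν`, the woman `x` is the deferred acceptance partner of `m` or prefers her partner
to `m`. -/
def Declines (P : Profile M W) (m : M) (ν : M ≃ W) (x : W) : Prop :=
  x = P.DA m ∨ (P.women x).prefers (ν.symm x) m

theorem Declines.mono {m : M} {ν ν' : M ≃ W} {x : W} (h : P.Declines m ν x)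
    (hle : (P.women x).weaklyPrefers (ν'.symm x) (ν.symm x)) : P.Declines m ν' x :=
  h.imp_right hle.trans_prefers

/-- With `m` at `μ(m)`, only the set of women above `μ(m)` matters, so the order inside the two
parts is irrelevant. A pushed-up `μ(m)` imposes no constraint. -/
theorem isStable_withList_iff {m : M} {X : Finset W} {L : PrefList W} (hL : P.IsPushUp m X L)
    {ν : M ≃ W} (hm : ν m = P.DA m) :
    (P.withList m L).IsStable ν ↔ P.IsStable ν ∧ ∀ x ∈ X, P.Declines m ν x := by
  have hself := P.withList_men_self m L
  have hwomen : (P.withList m L).women = P.women := rfl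
  constructor
  · intro h
    refine ⟨fun a w hw => ?_, fun x hx => ?_⟩
    · by_cases ha : a = m
      · subst ha
        have hne : w ≠ P.DA a := by
          rintro rfl
          rw [hm] at hw
          exact PrefList.irrefl _ _ hw
        rw [hm] at hw
        have := h a w
        rw [hself, hm] at this
        exact this ((hL w hne).2 (Or.inl hw))
      · have := h a w
        rw [P.withList_men_of_ne ha] at this
        exact this hw
    · by_cases hne : x = P.DA m
      · exact Or.inl hne
      · have := h m x
        rw [hself, hm] at this
        exact Or.inr (this ((hL x hne).2 (Or.inr hx)))
  · rintro ⟨h, hX⟩ a w hw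
    rw [hwomen]
    by_cases ha : a = m
    · subst ha
      rw [hself, hm] at hw
      have hne : w ≠ P.DA a := by
        rintro rfl
        exact PrefList.irrefl _ _ hw
      rcases (hL w hne).1 hw with h' | h'
      · exact h a w (by rwa [hm])
      · exact (hX w h').resolve_left hne
    · rw [P.withList_men_of_ne ha] at hw
      exact h a w hw

theorem stable_off_pushUpMatching (P : Profile M W) (m : M) (up : P.PushUpRule m) (X : Finset W)
    (a : M) (ha : a ≠ m) (w : W) (h : (P.men a).prefers w (P.pushUpMatching m up X a)) :
    (P.women w).prefers ((P.pushUpMatching m up X).symm w) a := by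
  rw [← P.withList_men_of_ne ha (up X).1] at h
  exact (P.withList m (up X).1).DA_isStable a w h

theorem pushUpMatching_singleton_apply {m : M} {up : P.PushUpRule m} {x : W}
    (hx : x ∈ P.noRegretSet m up) : P.pushUpMatching m up {x} m = P.DA m := by
  have h : (P.men m).weaklyPrefers (P.pushUpMatching m up {x} m) (P.DA m) := by
    simpa [noRegretSet] using hx
  exact h.resolve_left
    (not_prefers_DA_of_stable_off (P.stable_off_pushUpMatching m up {x}))

theorem isStable_and_declines_pushUpMatching {m : M} {up : P.PushUpRule m} {X : Finset W}
    (hm : P.pushUpMatching m up X m = P.DA m) :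
    P.IsStable (P.pushUpMatching m up X) ∧
      ∀ x ∈ X, P.Declines m (P.pushUpMatching m up X) x :=
  (isStable_withList_iff (up X).2 hm).1 (P.withList m (up X).1).DA_isStable

/-- The matching induced by pushing up `X` is the worst one for the women among the stable matchings
in which the women of `X` decline `m`. -/
theorem weaklyPrefers_pushUpMatching {m : M} (up : P.PushUpRule m) {X : Finset W} {ν : M ≃ W}
    (hm : ν m = P.DA m) (hν : P.IsStable ν) (hX : ∀ x ∈ X, P.Declines m ν x) (w : W) :
    (P.women w).weaklyPrefers (ν.symm w) ((P.pushUpMatching m up X).symm w) :=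
  ((isStable_withList_iff (up X).2 hm).2 ⟨hν, hX⟩).women_weaklyPrefer w

/-- The join of the matchings induced by pushing up the elements of `X` one at a time. -/
theorem exists_join_pushUpMatching {m : M} {up : P.PushUpRule m} (X : Finset W)
    (hX : X ⊆ P.noRegretSet m up) :
    ∃ ν : M ≃ W, P.IsStable ν ∧
      (∀ w, ν.symm w = P.DA.symm w ∨
        ∃ y ∈ X, ν.symm w = (P.pushUpMatching m up {y}).symm w) ∧
      ∀ y ∈ X, ∀ w,
        (P.women w).weaklyPrefers (ν.symm w) ((P.pushUpMatching m up {y}).symm w) := by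
  classical
  induction X using Finset.induction_on with
  | empty => exact ⟨P.DA, P.DA_isStable, fun w => Or.inl rfl, fun y hy => by simp at hy⟩
  | insert x X _ ih =>
    obtain ⟨ν, hν, hsel, hle⟩ := ih ((Finset.subset_insert x X).trans hX)
    have hx := pushUpMatching_singleton_apply (hX (Finset.mem_insert_self x X))
    obtain ⟨ν', hν', h⟩ := hν.exists_join (isStable_and_declines_pushUpMatching hx).1
    refine ⟨ν', hν', fun w => ?_, fun y hy w => ?_⟩
    · rcases (h w).1 with h' | h'
      · rw [h']
        exact (hsel w).imp_right fun ⟨y, hy, hyw⟩ => ⟨y, Finset.mem_insert_of_mem hy, hyw⟩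
      · exact Or.inr ⟨x, Finset.mem_insert_self x X, h'⟩
    · rcases Finset.mem_insert.1 hy with rfl | hy
      · exact (h w).2.2
      · exact (h w).2.1.trans (hle y hy w)

theorem pushUpMatching_apply_of_subset {m : M} {up : P.PushUpRule m} {X : Finset W}
    (hX : X ⊆ P.noRegretSet m up) :
    P.pushUpMatching m up X m = P.DA m ∧ ∀ w,
      (P.pushUpMatching m up X).symm w = P.DA.symm w ∨
        ∃ y ∈ X, (P.pushUpMatching m up X).symm w = (P.pushUpMatching m up {y}).symm w := by
  obtain ⟨ν, hν, hsel, hle⟩ := exists_join_pushUpMatching X hX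
  have hνm : ν m = P.DA m := by
    rw [eq_comm, ← Equiv.symm_apply_eq, eq_comm]
    rcases hsel (P.DA m) with h | ⟨y, hy, h⟩
    · rw [h, Equiv.symm_apply_apply]
    · rw [h, eq_comm, Equiv.symm_apply_eq]
      exact (pushUpMatching_singleton_apply (hX hy)).symm
  have hdec : ∀ x ∈ X, P.Declines m ν x := fun x hx =>
    ((isStable_and_declines_pushUpMatching (pushUpMatching_singleton_apply (hX hx))).2 x
      (Finset.mem_singleton_self x)).mono (hle x hx x)
  -- The join is stable for the pushed-up list, so a different partner `x` must stand above `μ(m)`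
  -- there. If truly preferred, she contradicts the blocking lemma for `P`; if `x ∈ X`, she
  -- contradicts it for the profile pushing up `{x}`, where `m` still gets `μ(m)`.
  have hm : P.pushUpMatching m up X m = P.DA m := by
    by_contra hne
    have h := ((isStable_withList_iff (up X).2 hνm).2 ⟨hν, hdec⟩).men_weaklyPrefer_DA m
    rw [hνm, P.withList_men_self] at h
    change (up X).1.weaklyPrefers (P.pushUpMatching m up X m) (P.DA m) at h
    rcases ((up X).2 _ hne).1 (h.resolve_right hne) with h' | h'
    · exact not_prefers_DA_of_stable_off (P.stable_off_pushUpMatching m up X) h'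
    · set x := P.pushUpMatching m up X m with hx
      have hx' := pushUpMatching_singleton_apply (hX h')
      refine not_prefers_DA_of_stable_off (P := P.withList m (up {x}).1) (m := m)
        (ν := P.pushUpMatching m up X) (fun a ha w hw => ?_) ?_
      · rw [P.withList_men_of_ne ha] at hw
        exact P.stable_off_pushUpMatching m up X a ha w hw
      · change ((P.withList m (up {x}).1).men m).prefers x (P.pushUpMatching m up {x} m)
        rw [P.withList_men_self, hx']
        exact ((up {x}).2 _ hne).2 (Or.inr (Finset.mem_singleton_self x))
  refine ⟨hm, fun w => ?_⟩
  obtain ⟨hst, hdecX⟩ := isStable_and_declines_pushUpMatching hm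
  -- The join meets the constraints defining `μ^X`, and `μ^X` is an upper bound of the matchings
  -- joined.
  have heq : (P.pushUpMatching m up X).symm w = ν.symm w := by
    refine PrefList.weaklyPrefers_antisymm (P.women w) ?_
      (weaklyPrefers_pushUpMatching up hνm hν hdec w)
    rcases hsel w with h | ⟨y, hy, h⟩
    · rw [h]
      exact hst.women_weaklyPrefer w
    · rw [h]
      refine weaklyPrefers_pushUpMatching up hm hst (fun x hx => ?_) w
      rw [Finset.mem_singleton.1 hx]
      exact hdecX y hy
  rw [heq]
  exact hsel w

theorem declines_pushUpMatching_iff {m : M} {up : P.PushUpRule m} {X : Finset W}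
    (hX : X ⊆ P.noRegretSet m up) (x : W) :
    P.Declines m (P.pushUpMatching m up X) x ↔
      P.Declines m P.DA x ∨ ∃ y ∈ X, P.Declines m (P.pushUpMatching m up {y}) x := by
  obtain ⟨hm, hsel⟩ := pushUpMatching_apply_of_subset hX
  obtain ⟨hst, hdec⟩ := isStable_and_declines_pushUpMatching hm
  constructor
  · intro h
    rcases hsel x with hx | ⟨y, hy, hx⟩
    · exact Or.inl (h.mono (Or.inr hx.symm))
    · exact Or.inr ⟨y, hy, h.mono (Or.inr hx.symm)⟩
  · rintro (h | ⟨y, hy, h⟩)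
    · exact h.mono (hst.women_weaklyPrefer x)
    · refine h.mono (weaklyPrefers_pushUpMatching up hm hst (fun z hz => ?_) x)
      rw [Finset.mem_singleton.1 hz]
      exact hdec y hy

/-- If all of `N` declines under `μ^X`, then `μ^X` and `μ^N` each satisfy the constraints of the
other, and both are women-worst. -/
theorem pushUpMatching_eq_noRegretSet_iff {m : M} {up : P.PushUpRule m} {X : Finset W}
    (hX : X ⊆ P.noRegretSet m up) :
    P.pushUpMatching m up X = P.pushUpMatching m up (P.noRegretSet m up) ↔
      ∀ x ∈ P.noRegretSet m up, P.Declines m P.DA x ∨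
        ∃ y ∈ X, P.Declines m (P.pushUpMatching m up {y}) x := by
  have hm := (pushUpMatching_apply_of_subset hX).1
  have hmN := (pushUpMatching_apply_of_subset (Finset.Subset.refl (P.noRegretSet m up))).1
  obtain ⟨hst, hdec⟩ := isStable_and_declines_pushUpMatching hm
  obtain ⟨hstN, hdecN⟩ := isStable_and_declines_pushUpMatching hmN
  simp only [← declines_pushUpMatching_iff hX]
  constructor
  · intro h
    rw [h]
    exact hdecN
  · intro h
    refine Equiv.symm_bijective.injective (Equiv.ext fun w => ?_)
    exact PrefList.weaklyPrefers_antisymm (P.women w)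
      (weaklyPrefers_pushUpMatching up hm hst h w)
      (weaklyPrefers_pushUpMatching up hmN hstN (fun x hx => hdecN x (hX hx)) w)

end Profile

end StableMarriage

open StableMarriage Profile in
theorem mainTheorem3 {M W : Type*} [Fintype M] [Fintype W]
    (P : StableMarriage.Profile M W) (m : M) (up : P.PushUpRule m) (Y : Finset W)
    (hY : P.IsMinimalNoRegretPushUpSet m up Y) :
    P.IsMinimumNoRegretPushUpSet m up Y := by
  obtain ⟨hYN, hYeq, hmin⟩ := hY
  refine ⟨hYN, hYeq, ?_⟩
  rintro ⟨Z, hZN, hZeq, hlt⟩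
  have hsingle : ∀ y ∈ P.noRegretSet m up,
      P.pushUpMatching m up {y} m = P.DA m ∧ P.IsStable (P.pushUpMatching m up {y}) :=
    fun y hy =>
    have hm := pushUpMatching_singleton_apply hy
    ⟨hm, (isStable_and_declines_pushUpMatching hm).1⟩
  refine absurd hlt (not_lt.2 (card_le_card_of_minimal_cover
    (N := P.noRegretSet m up) (B := fun x => P.Declines m P.DA x)
    (D := fun x y => P.Declines m (P.pushUpMatching m up {y}) x)
    ?_ ?_ hYN hZN
    ((pushUpMatching_eq_noRegretSet_iff hYN).1 hYeq)
    ((pushUpMatching_eq_noRegretSet_iff hZN).1 hZeq) ?_))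
  -- As `y` declines under `μ^{z}`, all women weakly prefer `μ^{z}` to `μ^{y}`, so `x` still
  -- declines. The next goal is the same with `μ` for `μ^{z}`.
  · intro x _ y _ z hz hxy hyz
    obtain ⟨hm, hst⟩ := hsingle z hz
    exact hxy.mono (weaklyPrefers_pushUpMatching up hm hst
      (fun v hv => Finset.mem_singleton.1 hv ▸ hyz) x)
  · intro x _ y _ hxy hy
    exact hxy.mono (weaklyPrefers_pushUpMatching up rfl P.DA_isStable
      (fun v hv => Finset.mem_singleton.1 hv ▸ hy) x)
  · intro Y' hY' h
    exact hmin ⟨Y', (pushUpMatching_eq_noRegretSet_iff (hY'.subset.trans hYN)).2 h, hY'⟩
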